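/- Let $\Omega\subseteq\mathbb R^2$ be a connected open set, let $N\in\mathbb N$, and let $u=(u_1,\dots,u_N)\in C^2(\Omega;\mathbb R^N)$ be $\infty$-harmonic, i.e. for every $\alpha\in\{1,\dots,N\}$ $$\sum_{i,j=1}^{2}\sum_{\beta=1}^{N} D_iu_\alpha\, D_ju_\beta\, D^2_{ij}u_\beta\;+\;|Du|^2\sum_{\beta=1}^{N}\sum_{i=1}^{2}[Du]^{\perp}_{\alpha\beta}\,D^2_{ii}u_\beta\;=\;0\quad\text{on }\Omega,$$ where $Du=(D_iu_\alpha)_{\alpha i}$ is the $N\times 2$ gradient matrix, $|Du|=\big(\sum_{\alpha,i}(D_iu_\alpha)^2\big)^{1/2}$ is its Euclidean norm, and $[Du(x)]^{\perp}$ is the matrix of the orthogonal projection of $\mathbb R^N$ onto the nullspace of $Du(x)^\top:\mathbb R^N\to\mathbb R^2$. Then either $|Du|>0$ everywhere on $\Omega$, or $|Du|\equiv 0$ on $\Omega$. Hence, if $u$ is not constant on $\Omega$, then $\operatorname{rank}(Du(x))\ge 1$ for every $x\in\Omega$. -/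

import Mathlib

noncomputable section

/-- The gradient matrix `Du(x)`, an `N × n` matrix with entries `(Du)_{α i} = D_i u_α(x)`. -/
def gradMatrix {n N : ℕ} (u : EuclideanSpace ℝ (Fin n) → EuclideanSpace ℝ (Fin N))
    (x : EuclideanSpace ℝ (Fin n)) : Matrix (Fin N) (Fin n) ℝ :=
  Matrix.of fun α i => fderiv ℝ (fun y => u y α) x (EuclideanSpace.single i 1)

/-- The second partial derivative `D²_{ij} u_α(x) = D_j (D_i u_α)(x)`. -/
def secondPartial {n N : ℕ} (u : EuclideanSpace ℝ (Fin n) → EuclideanSpace ℝ (Fin N))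
    (x : EuclideanSpace ℝ (Fin n)) (α : Fin N) (i j : Fin n) : ℝ :=
  fderiv ℝ (fun y => gradMatrix u y α i) x (EuclideanSpace.single j 1)

/-- The Euclidean norm `|P| = (P_{α i} P_{α i})^{1/2}` of an `N × n` matrix. -/
def matrixNorm {n N : ℕ} (P : Matrix (Fin N) (Fin n) ℝ) : ℝ :=
  Real.sqrt (∑ α, ∑ i, P α i ^ 2)

/-- The nullspace of `Pᵀ : ℝᴺ → ℝⁿ`, as a subspace of Euclidean space `ℝᴺ`. -/
def transposeKer {n N : ℕ} (P : Matrix (Fin N) (Fin n) ℝ) :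
    Submodule ℝ (EuclideanSpace ℝ (Fin N)) :=
  LinearMap.ker (Matrix.toEuclideanLin P.transpose)

/-- The matrix `[P]^⊥` of the orthogonal projection of `ℝᴺ` onto the nullspace of `Pᵀ`. -/
def normalProj {n N : ℕ} (P : Matrix (Fin N) (Fin n) ℝ) : Matrix (Fin N) (Fin N) ℝ :=
  Matrix.of fun α β => (transposeKer P).starProjection (EuclideanSpace.single β 1) α

/-- The `α`-th component of the `∞`-Laplacian of `u` at `x`:
`D_i u_α D_j u_β D²_{ij} u_β + |Du|² [Du]^⊥_{αβ} D²_{ii} u_β` (summation over `i`, `j`, `β`). -/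
def inftyLaplacian {n N : ℕ} (u : EuclideanSpace ℝ (Fin n) → EuclideanSpace ℝ (Fin N))
    (x : EuclideanSpace ℝ (Fin n)) (α : Fin N) : ℝ :=
  (∑ i, ∑ j, ∑ β, gradMatrix u x α i * gradMatrix u x β j * secondPartial u x β i j)
    + matrixNorm (gradMatrix u x) ^ 2 *
      ∑ β, ∑ i, normalProj (gradMatrix u x) α β * secondPartial u x β i i

/-- `u` is an `∞`-harmonic map of class `C²` on the (open) set `Ω`. -/
def IsInftyHarmonicOn {n N : ℕ} (u : EuclideanSpace ℝ (Fin n) → EuclideanSpace ℝ (Fin N))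
    (Ω : Set (EuclideanSpace ℝ (Fin n))) : Prop :=
  ContDiffOn ℝ 2 u Ω ∧ ∀ x ∈ Ω, ∀ α, inftyLaplacian u x α = 0

end

open scoped RealInnerProductSpace
open Filter Topology

/-! The tangential part of the system reads Du D(|Du|²) = 0, so w = |Du|² is constant along the flow
of every Du_α. Zeros of Du are excluded by a Hopf-type argument. On a disc of centre y and radius R
with Du ≠ 0 inside, w is compared near the boundary with c (R² - |x - y|²)²
(`exists_mul_sq_le_sum_norm_sq`). At a negative minimum of the difference, Dw is radial and nonzero,
so in the plane all Du_α are parallel nearby and orthogonal to the radius. The flow of a nonzero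
Du_α stays in a level set of w lying locally outside the open disc through that point, and the
resulting second order inequality (`two_mul_le_of_fderiv_eq`) is violated there.

Hence w grows at least quadratically along the inner normal at a boundary point. At a zero of Du,
however, blow-up gives a quadratic solution, which must be trivial (`eq_zero_of_sum_inner_eq_zero`),
so w is o(|x - x₀|²). If Du had both zeros and nonzeros in a connected Ω, some disc free of zeros
would touch a zero, a contradiction. -/

/-- Along the integral curve of a vector field `F` tangent to the level sets of `w`, the second order
condition for a point of the level set that is closest to `y`. -/
theorem norm_sq_add_inner_fderiv_nonneg_of_isLocalMin_dist
    {E : Type*} [NormedAddCommGroup E] [InnerProductSpace ℝ E] [CompleteSpace E]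
    {F : E → E} {w : E → ℝ} {p y : E} (hF : ContDiffAt ℝ 1 F p)
    (hw : ∀ᶠ x in 𝓝 p, ∃ w' : E →L[ℝ] ℝ, HasFDerivAt w w' x ∧ w' (F x) = 0)
    (hmin : ∀ᶠ x in 𝓝 p, w x = w p → ‖p - y‖ ^ 2 ≤ ‖x - y‖ ^ 2) :
    0 ≤ ‖F p‖ ^ 2 + ⟪p - y, fderiv ℝ F p (F p)⟫ := by
  obtain ⟨γ, hγ0, ε, hε, hγ⟩ :=
    hF.exists_forall_mem_closedBall_exists_eq_forall_mem_Ioo_hasDerivAt₀ 0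
  have hγc : ContinuousAt γ 0 := (hγ 0 (by simp [hε])).continuousAt
  have hγt : Tendsto γ (𝓝 0) (𝓝 p) := by simpa [ContinuousAt, hγ0] using hγc
  have hγe : ∀ᶠ t in 𝓝 (0 : ℝ), HasDerivAt γ (F (γ t)) t := by
    filter_upwards [Ioo_mem_nhds (show 0 - ε < 0 by linarith) (show 0 < 0 + ε by linarith)] with t ht
    exact hγ t ht
  have hconst : ∀ᶠ t in 𝓝 (0 : ℝ), w (γ t) = w p := by
    obtain ⟨δ, hδ, hball⟩ := Metric.eventually_nhds_iff_ball.1 (hγe.and (hγt.eventually hw))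
    have hder : ∀ t ∈ Metric.ball (0 : ℝ) δ, HasDerivAt (fun t => w (γ t)) 0 t := by
      intro t ht
      obtain ⟨h1, w', h2, h3⟩ := hball t ht
      have := h2.comp_hasDerivAt t h1
      rwa [h3] at this
    filter_upwards [Metric.ball_mem_nhds (0 : ℝ) hδ] with t ht
    have := Metric.isOpen_ball.is_const_of_fderiv_eq_zero (𝕜 := ℝ)
      (convex_ball (0 : ℝ) δ).isPreconnected
      (fun s hs => (hder s hs).differentiableAt.differentiableWithinAt)
      (fun s hs => by
        ext; simpa using (hder s hs).deriv) ht (Metric.mem_ball_self hδ)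
    simpa [hγ0] using this
  set h : ℝ → ℝ := fun t => ‖γ t - y‖ ^ 2 with hh
  have hlm : IsLocalMin h 0 := by
    filter_upwards [hconst, hγt.eventually hmin] with t h1 h2
    simpa [hh, hγ0] using h2 h1
  have hd : deriv h =ᶠ[𝓝 0] fun t => 2 * ⟪γ t - y, F (γ t)⟫ := by
    filter_upwards [hγe] with t ht
    exact (ht.sub_const y).norm_sq.deriv
  have hd2 : HasDerivAt (deriv h) (2 * (‖F p‖ ^ 2 + ⟪p - y, fderiv ℝ F p (F p)⟫)) 0 := by
    refine HasDerivAt.congr_of_eventuallyEq ?_ hd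
    have hFp : HasFDerivAt F (fderiv ℝ F p) (γ 0) := by
      rw [hγ0]; exact (hF.differentiableAt one_ne_zero).hasFDerivAt
    have h1 := hγe.self_of_nhds
    have h2 := hFp.comp_hasDerivAt (0 : ℝ) h1
    have h3 := ((h1.sub_const y).inner ℝ h2).const_mul 2
    simp only [Function.comp_apply, hγ0, real_inner_self_eq_norm_sq] at h3
    rwa [add_comm (‖F p‖ ^ 2)]
  -- A negative second derivative would make 0 a local maximum as well as a local minimum, so `h`
  -- would be locally constant and its second derivative zero.
  by_contra! hneg
  have hlM : IsLocalMax h 0 := by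
    refine isLocalMax_of_deriv_deriv_neg ?_ hlm.deriv_eq_zero ((hγc.sub_const y).norm.pow 2)
    rw [hd2.deriv]; linarith
  have hc : h =ᶠ[𝓝 0] fun _ => h 0 := by
    filter_upwards [hlm, hlM] with t h1 h2 using le_antisymm h2 h1
  have h0 : deriv (deriv h) 0 = 0 := by
    rw [hc.deriv.deriv_eq]; simp
  rw [hd2.deriv] at h0
  linarith

/-! ### Linear algebra of the second derivatives -/

/-- Self-adjoint operators `A α` that solve the tangential system for quadratic maps vanish. -/
theorem eq_zero_of_sum_inner_eq_zero {ι E : Type*} [Fintype ι] [NormedAddCommGroup E]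
    [InnerProductSpace ℝ E] [FiniteDimensional ℝ E] (A : ι → E →L[ℝ] E)
    (hA : ∀ α v w, ⟪A α v, w⟫ = ⟪v, A α w⟫)
    (h : ∀ α x, ∑ β, ⟪A β (A α x), A β x⟫ = 0) (α : ι) : A α = 0 := by
  classical
  set M : E →L[ℝ] E := ∑ β, A β ∘L A β with hM
  have hMi : ∀ v w, ⟪v, M w⟫ = ∑ β, ⟪A β v, A β w⟫ := by
    intro v w
    simp [hM, inner_sum, hA]
  have hpol : ∀ α x y, ⟪A α x, M y⟫ + ⟪A α y, M x⟫ = 0 := by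
    intro α x y
    have h1 := h α (x + y)
    have h2 := h α x
    have h3 := h α y
    rw [← hMi] at h1 h2 h3
    simp only [map_add, inner_add_left, inner_add_right] at h1
    linarith
  let e := stdOrthonormalBasis ℝ E
  -- The polarized identity with y = A_α x, summed over α, gives Σ ⟪A_α x, M A_α x⟫ + |M x|² = 0.
  -- Since M = Σ A_β² is positive semidefinite, both terms vanish.
  have hsum : ∑ i, ((∑ α, ⟪A α (e i), M (A α (e i))⟫) + ⟪M (e i), M (e i)⟫) = 0 := by
    refine Finset.sum_eq_zero fun i _ => ?_
    have : ⟪M (e i), M (e i)⟫ = ∑ α, ⟪A α (A α (e i)), M (e i)⟫ := by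
      nth_rewrite 1 [hM]
      simp [sum_inner]
    rw [this, ← Finset.sum_add_distrib]
    exact Finset.sum_eq_zero fun α _ => hpol α _ _
  have hnn : ∀ v, 0 ≤ ⟪v, M v⟫ := fun v => by
    rw [hMi]; exact Finset.sum_nonneg fun β _ => real_inner_self_nonneg
  have hMe : ∀ i, M (e i) = 0 := by
    intro i
    have := (Finset.sum_eq_zero_iff_of_nonneg (fun i _ => add_nonneg
      (Finset.sum_nonneg fun α _ => hnn _) real_inner_self_nonneg)).1 hsum i (Finset.mem_univ i)
    have h2 : 0 ≤ ∑ α, ⟪A α (e i), M (A α (e i))⟫ := Finset.sum_nonneg fun α _ => hnn _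
    have h3 : 0 ≤ ⟪M (e i), M (e i)⟫ := real_inner_self_nonneg
    exact inner_self_eq_zero (𝕜 := ℝ).1 (by linarith)
  have hAe : ∀ i, A α (e i) = 0 := by
    intro i
    have := hMi (e i) (e i)
    rw [hMe, inner_zero_right, eq_comm, Finset.sum_eq_zero_iff_of_nonneg
      (fun β _ => real_inner_self_nonneg)] at this
    exact inner_self_eq_zero (𝕜 := ℝ).1 (this α (Finset.mem_univ α))
  ext v
  rw [← e.sum_repr v]
  simp [hAe]

/-- Two planar gradients staying parallel: the components of their derivatives transversal to the
common direction are proportional to the squared lengths. -/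
theorem inner_mul_norm_sq_eq_of_cross_eq_zero (p q z : EuclideanSpace ℝ (Fin 2))
    (A B : EuclideanSpace ℝ (Fin 2) →L[ℝ] EuclideanSpace ℝ (Fin 2))
    (hA : ∀ v w, ⟪A v, w⟫ = ⟪v, A w⟫) (hB : ∀ v w, ⟪B v, w⟫ = ⟪v, B w⟫)
    (hz : z ≠ 0) (hp : ⟪z, p⟫ = 0) (hq : ⟪z, q⟫ = 0)
    (h : ∀ v, A v 0 * q 1 + p 0 * B v 1 - (A v 1 * q 0 + p 1 * B v 0) = 0) :
    ⟪B z, q⟫ * ‖p‖ ^ 2 = ⟪A z, p⟫ * ‖q‖ ^ 2 := by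
  -- `z` rotated by a quarter turn: `p` and `q` are multiples of it, and `h` is needed only in this
  -- direction.
  let e : EuclideanSpace ℝ (Fin 2) := !₂[-z 1, z 0]
  have hz2 : 0 < z 0 ^ 2 + z 1 ^ 2 := by
    rcases eq_or_ne (z 0) 0 with h0 | h0
    · rcases eq_or_ne (z 1) 0 with h1 | h1
      · exact absurd (by ext i; fin_cases i <;> simp [h0, h1]) hz
      · positivity
    · positivity
  have key : ∀ p : EuclideanSpace ℝ (Fin 2), ⟪z, p⟫ = 0 → ∃ s : ℝ, p = s • e := by
    intro p hp
    simp only [PiLp.inner_apply, Fin.sum_univ_two, RCLike.inner_apply, conj_trivial] at hp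
    refine ⟨(z 0 * p 1 - z 1 * p 0) / (z 0 ^ 2 + z 1 ^ 2), ?_⟩
    ext i
    fin_cases i <;> simp [e] <;> field_simp
    · linear_combination (z 0) * hp
    · linear_combination (z 1) * hp
  obtain ⟨s, rfl⟩ := key p hp
  obtain ⟨t, rfl⟩ := key q hq
  have he : t * ⟪A e, z⟫ = s * ⟪B e, z⟫ := by
    have := h e
    simp only [PiLp.inner_apply, Fin.sum_univ_two, RCLike.inner_apply, conj_trivial,
      PiLp.smul_apply, smul_eq_mul] at this ⊢
    have e0 : e 0 = -z 1 := rfl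
    have e1 : e 1 = z 0 := rfl
    rw [e0, e1] at this
    linear_combination this
  have hs : ‖s‖ ^ 2 = s ^ 2 := by simp
  have ht : ‖t‖ ^ 2 = t ^ 2 := by simp
  rw [inner_smul_right, inner_smul_right, norm_smul, norm_smul, mul_pow, mul_pow, hs, ht,
    hA, hB, real_inner_comm, real_inner_comm (A e)]
  linear_combination (-s * t * ‖e‖ ^ 2) * he

/-! ### Tangential systems in the plane -/

/-- Planar fields `P α` that are `C¹` with symmetric derivative (locally gradients of functions `u α`)
and solve the tangential system `Du D(|Du|²) = 0`. -/
structure IsTangentialGradientSystem {ι : Type*} [Fintype ι]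
    (P : ι → EuclideanSpace ℝ (Fin 2) → EuclideanSpace ℝ (Fin 2))
    (Ω : Set (EuclideanSpace ℝ (Fin 2))) : Prop where
  contDiffAt : ∀ α, ∀ x ∈ Ω, ContDiffAt ℝ 1 (P α) x
  symm : ∀ α, ∀ x ∈ Ω, ∀ v w, ⟪fderiv ℝ (P α) x v, w⟫ = ⟪v, fderiv ℝ (P α) x w⟫
  sum_inner_eq_zero : ∀ α, ∀ x ∈ Ω, ∑ β, ⟪fderiv ℝ (P β) x (P α x), P β x⟫ = 0

namespace IsTangentialGradientSystem

variable {ι : Type*} [Fintype ι] {P : ι → EuclideanSpace ℝ (Fin 2) → EuclideanSpace ℝ (Fin 2)}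
  {Ω : Set (EuclideanSpace ℝ (Fin 2))}

theorem hasFDerivAt (hP : IsTangentialGradientSystem P Ω) (α : ι) {x : EuclideanSpace ℝ (Fin 2)}
    (hx : x ∈ Ω) : HasFDerivAt (P α) (fderiv ℝ (P α) x) x :=
  ((hP.contDiffAt α x hx).differentiableAt one_ne_zero).hasFDerivAt

theorem continuousAt_fderiv (hP : IsTangentialGradientSystem P Ω) (α : ι)
    {x : EuclideanSpace ℝ (Fin 2)} (hx : x ∈ Ω) : ContinuousAt (fderiv ℝ (P α)) x :=
  (hP.contDiffAt α x hx).continuousAt_fderiv one_ne_zero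

theorem continuousOn_sum_norm_sq (hP : IsTangentialGradientSystem P Ω) :
    ContinuousOn (fun x => ∑ β, ‖P β x‖ ^ 2) Ω := by
  intro x hx
  have : ∀ β, ContinuousAt (P β) x := fun β => (hP.contDiffAt β x hx).continuousAt
  exact (by fun_prop : ContinuousAt (fun x => ∑ β, ‖P β x‖ ^ 2) x).continuousWithinAt

/-- For v = P α x the sum is the one in the tangential system, so |Du|² is stationary in the
direction of every Du_α. -/
theorem exists_hasFDerivAt_sum_norm_sq (hP : IsTangentialGradientSystem P Ω)
    {x : EuclideanSpace ℝ (Fin 2)} (hx : x ∈ Ω) :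
    ∃ w' : EuclideanSpace ℝ (Fin 2) →L[ℝ] ℝ,
      HasFDerivAt (fun x => ∑ β, ‖P β x‖ ^ 2) w' x ∧
        ∀ v, w' v = 2 * ∑ β, ⟪fderiv ℝ (P β) x v, P β x⟫ := by
  refine ⟨_, HasFDerivAt.fun_sum fun β _ => (hP.hasFDerivAt β hx).norm_sq, fun v => ?_⟩
  simp [Finset.mul_sum, real_inner_comm]

/-- Wherever the gradient of `|Du|²` does not vanish, all `Du_α` are parallel nearby. -/
theorem eventually_cross_eq_zero (hP : IsTangentialGradientSystem P Ω) (hΩ : IsOpen Ω)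
    {p v : EuclideanSpace ℝ (Fin 2)} (hp : p ∈ Ω)
    (hv : ∑ β, ⟪fderiv ℝ (P β) p v, P β p⟫ ≠ 0) (α β : ι) :
    ∀ᶠ x in 𝓝 p, P α x 0 * P β x 1 - P α x 1 * P β x 0 = 0 := by
  have hc : ContinuousAt (fun x => ∑ β, ⟪fderiv ℝ (P β) x v, P β x⟫) p := by
    have h1 : ∀ β, ContinuousAt (P β) p := fun β => (hP.contDiffAt β p hp).continuousAt
    have h2 : ∀ β, ContinuousAt (fun x => fderiv ℝ (P β) x v) p := fun β =>
      (hP.continuousAt_fderiv β hp).clm_apply continuousAt_const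
    fun_prop
  filter_upwards [hc.eventually_ne hv, hΩ.mem_nhds hp] with x hx hxΩ
  obtain ⟨w', -, hw'⟩ := hP.exists_hasFDerivAt_sum_norm_sq hxΩ
  have hα : w' (P α x) = 0 := by rw [hw', hP.sum_inner_eq_zero α x hxΩ, mul_zero]
  have hβ : w' (P β x) = 0 := by rw [hw', hP.sum_inner_eq_zero β x hxΩ, mul_zero]
  have hne : w' v ≠ 0 := by rw [hw']; simpa using hx
  -- If `P α x` and `P β x` were independent, Cramer's rule would express `v` through them, forcing
  -- `w' v = 0`.
  by_contra hD
  apply hne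
  set D := P α x 0 * P β x 1 - P α x 1 * P β x 0 with hDdef
  have : v = ((v 0 * P β x 1 - v 1 * P β x 0) / D) • P α x +
      ((P α x 0 * v 1 - P α x 1 * v 0) / D) • P β x := by
    ext i
    fin_cases i <;> simp <;> field_simp <;> rw [hDdef] <;> ring
  rw [this, map_add, map_smul, map_smul, hα, hβ]
  simp

/-- First order information at an interior minimum of `|Du|² - c (R² - |x - y|²)²` gives a bound on the
location of the minimum. -/
theorem two_mul_le_of_fderiv_eq (hP : IsTangentialGradientSystem P Ω) (hΩ : IsOpen Ω)
    {p y : EuclideanSpace ℝ (Fin 2)} {k : ℝ} (hp : p ∈ Ω) (hk : k ≠ 0) (hpy : p ≠ y)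
    (hpos : 0 < ∑ β, ‖P β p‖ ^ 2)
    (hder : ∀ v, ∑ β, ⟪fderiv ℝ (P β) p v, P β p⟫ = -k * ⟪p - y, v⟫)
    (hmin : ∀ᶠ x in 𝓝 p, ∑ β, ‖P β x‖ ^ 2 = ∑ β, ‖P β p‖ ^ 2 → ‖p - y‖ ^ 2 ≤ ‖x - y‖ ^ 2) :
    k * ‖p - y‖ ^ 2 ≤ ∑ β, ‖P β p‖ ^ 2 := by
  have hz : p - y ≠ 0 := sub_ne_zero.2 hpy
  have hz2 : ‖p - y‖ ^ 2 ≠ 0 := by simpa using hz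
  have hperp : ∀ α, ⟪p - y, P α p⟫ = 0 := fun α => by
    have := hder (P α p)
    rw [hP.sum_inner_eq_zero α p hp] at this
    simpa [hk] using this.symm
  have hcross := hP.eventually_cross_eq_zero hΩ (v := p - y) hp (by
    rw [hder, real_inner_self_eq_norm_sq]; exact mul_ne_zero (neg_ne_zero.2 hk) hz2)
  obtain ⟨α, hα⟩ : ∃ α, P α p ≠ 0 := by
    by_contra! h
    simp [h] at hpos
  have hcoord : ∀ β (i : Fin 2), HasFDerivAt (fun x => P β x i)
      ((EuclideanSpace.proj i : EuclideanSpace ℝ (Fin 2) →L[ℝ] ℝ) ∘L fderiv ℝ (P β) p) p :=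
    fun β i => (EuclideanSpace.proj i : EuclideanSpace ℝ (Fin 2) →L[ℝ] ℝ).hasFDerivAt.comp p
      (hP.hasFDerivAt β hp)
  have hprop : ∀ β, ⟪fderiv ℝ (P β) p (p - y), P β p⟫ * ‖P α p‖ ^ 2 =
      ⟪fderiv ℝ (P α) p (p - y), P α p⟫ * ‖P β p‖ ^ 2 := fun β => by
    refine inner_mul_norm_sq_eq_of_cross_eq_zero _ _ _ _ _ (hP.symm α p hp) (hP.symm β p hp) hz
      (hperp α) (hperp β) fun v => ?_
    have h1 := ((hcoord α 0).mul (hcoord β 1)).sub ((hcoord α 1).mul (hcoord β 0))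
    have h2 := h1.unique ((hasFDerivAt_const (0 : ℝ) p).congr_of_eventuallyEq (hcross α β))
    have h3 := congrArg (fun L => L v) h2
    simp at h3
    linarith
  -- Summing the proportionality over β expresses the radial derivative of |Du|² through the single
  -- index α, whose flow is used next.
  have hsum : -k * ‖p - y‖ ^ 2 * ‖P α p‖ ^ 2 =
      ⟪fderiv ℝ (P α) p (p - y), P α p⟫ * ∑ β, ‖P β p‖ ^ 2 := by
    rw [← real_inner_self_eq_norm_sq (p - y), ← hder, Finset.sum_mul, Finset.mul_sum]
    exact Finset.sum_congr rfl fun β _ => hprop β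
  have hflow := norm_sq_add_inner_fderiv_nonneg_of_isLocalMin_dist (hP.contDiffAt α p hp)
    (w := fun x => ∑ β, ‖P β x‖ ^ 2) (y := y) (by
      filter_upwards [hΩ.mem_nhds hp] with x hx
      obtain ⟨w', h1, h2⟩ := hP.exists_hasFDerivAt_sum_norm_sq hx
      exact ⟨w', h1, by rw [h2, hP.sum_inner_eq_zero α x hx, mul_zero]⟩) hmin
  rw [← hP.symm α p hp] at hflow
  have hα2 : 0 < ‖P α p‖ ^ 2 := by positivity
  have := mul_nonneg hflow hpos.le
  rw [add_mul, ← hsum] at this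
  refine le_of_mul_le_mul_left ?_ hα2
  linarith

/-! ### The Hopf type estimate -/

/-- A Hopf type lower bound for `|Du|²` near the boundary of a disc inside which `Du ≠ 0`. -/
theorem exists_mul_sq_le_sum_norm_sq (hP : IsTangentialGradientSystem P Ω) (hΩ : IsOpen Ω)
    {y : EuclideanSpace ℝ (Fin 2)} {R : ℝ} (hR : 0 < R) (hB : Metric.closedBall y R ⊆ Ω)
    (hpos : ∀ x ∈ Metric.ball y R, 0 < ∑ β, ‖P β x‖ ^ 2) :
    ∃ c > 0, ∀ x ∈ Metric.closedBall y R, R ^ 2 ≤ 2 * ‖x - y‖ ^ 2 →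
      c * (R ^ 2 - ‖x - y‖ ^ 2) ^ 2 ≤ ∑ β, ‖P β x‖ ^ 2 := by
  set w : EuclideanSpace ℝ (Fin 2) → ℝ := fun x => ∑ β, ‖P β x‖ ^ 2 with hw
  -- On the inner circle |x - y|² = R²/2 the barrier is at most c R⁴, so this `c` rules out a
  -- negative minimum there; on the outer circle the barrier vanishes.
  obtain ⟨c, hc, hcS⟩ : ∃ c > 0, ∀ x, 2 * ‖x - y‖ ^ 2 = R ^ 2 → c * R ^ 4 ≤ w x := by
    set S : Set (EuclideanSpace ℝ (Fin 2)) := {x | 2 * ‖x - y‖ ^ 2 = R ^ 2} with hS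
    have hSb : S ⊆ Metric.ball y R := fun x hx => by
      rw [Metric.mem_ball, dist_eq_norm]
      have : 2 * ‖x - y‖ ^ 2 = R ^ 2 := hx
      nlinarith [norm_nonneg (x - y)]
    have hSc : IsCompact S := (isCompact_closedBall y R).of_isClosed_subset
      (isClosed_eq (by fun_prop) (by fun_prop)) (hSb.trans Metric.ball_subset_closedBall)
    rcases S.eq_empty_or_nonempty with he | hne
    · exact ⟨1, one_pos, fun x hx => absurd (show x ∈ S from hx) (by simp [he])⟩
    · obtain ⟨x₁, hx₁, hm⟩ := hSc.exists_isMinOn hne (hP.continuousOn_sum_norm_sq.mono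
        ((hSb.trans Metric.ball_subset_closedBall).trans hB))
      refine ⟨w x₁ / R ^ 4, div_pos (hpos x₁ (hSb hx₁)) (by positivity), fun x hx => ?_⟩
      rw [div_mul_cancel₀ _ (by positivity)]
      exact hm hx
  refine ⟨c, hc, ?_⟩
  set K : Set (EuclideanSpace ℝ (Fin 2)) :=
    Metric.closedBall y R ∩ {x | R ^ 2 ≤ 2 * ‖x - y‖ ^ 2} with hK
  have hKc : IsCompact K := (isCompact_closedBall y R).inter_right
    (isClosed_le (by fun_prop) (by fun_prop))
  set φ : EuclideanSpace ℝ (Fin 2) → ℝ := fun x => w x - c * (R ^ 2 - ‖x - y‖ ^ 2) ^ 2 with hφ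
  by_contra! hcon
  obtain ⟨x₂, hx₂, hx₂', hx₂n⟩ := hcon
  obtain ⟨p, hpK, hpm⟩ := hKc.exists_isMinOn (f := φ) ⟨x₂, hx₂, hx₂'⟩
    ((hP.continuousOn_sum_norm_sq.mono (Set.inter_subset_left.trans hB)).sub (by fun_prop))
  have hφp : φ p < 0 := (hpm (a := x₂) ⟨hx₂, hx₂'⟩).trans_lt (by simp only [hφ, hw]; linarith)
  have hpΩ : p ∈ Ω := hB hpK.1
  have hw0 : 0 ≤ w p := Finset.sum_nonneg fun β _ => by positivity
  have hpR : ‖p - y‖ ≤ R := by simpa [dist_eq_norm] using hpK.1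
  have hp2 : R ^ 2 ≤ 2 * ‖p - y‖ ^ 2 := hpK.2
  have hpltR : ‖p - y‖ < R := by
    refine lt_of_le_of_ne hpR fun h => ?_
    simp only [hφ, h] at hφp
    linarith
  have hpb : p ∈ Metric.ball y R := by simpa [dist_eq_norm] using hpltR
  have hp2' : R ^ 2 < 2 * ‖p - y‖ ^ 2 := by
    refine lt_of_le_of_ne hp2 fun h => ?_
    have h1 := hcS p h.symm
    have h2 : (R ^ 2 - ‖p - y‖ ^ 2) ^ 2 ≤ R ^ 4 := by
      have : ‖p - y‖ ^ 2 = R ^ 2 / 2 := by linarith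
      rw [this]; nlinarith [pow_pos hR 4]
    simp only [hφ] at hφp
    nlinarith
  set g : ℝ := R ^ 2 - ‖p - y‖ ^ 2 with hg
  have hgpos : 0 < g := by rw [hg]; nlinarith [norm_nonneg (p - y)]
  have hlm : IsLocalMin φ p := by
    filter_upwards [Metric.isOpen_ball.mem_nhds hpb,
      (isOpen_lt (continuous_const (y := R ^ 2))
        (by fun_prop : Continuous fun x => 2 * ‖x - y‖ ^ 2)).mem_nhds hp2'] with x h1 h2
    exact hpm ⟨Metric.ball_subset_closedBall h1, le_of_lt h2⟩
  obtain ⟨w', hw', hw'v⟩ := hP.exists_hasFDerivAt_sum_norm_sq hpΩ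
  have hder : ∀ v, ∑ β, ⟪fderiv ℝ (P β) p v, P β p⟫ = -(2 * c * g) * ⟪p - y, v⟫ := fun v => by
    have h1 := hw'.sub (((((hasFDerivAt_id p).sub_const y).norm_sq.const_sub (R ^ 2)).pow 2).const_mul c)
    have h2 := hlm.hasFDerivAt_eq_zero h1
    have h3 := congrArg (fun L => L v) h2
    simp [hw'v, -map_sub] at h3
    linarith
  have hle := hP.two_mul_le_of_fderiv_eq hΩ hpΩ (k := 2 * c * g) (by positivity)
    -- The last argument shows `p` nearest to `y` on its level set: where `w` equals `w p`,
    -- minimality of `φ` says that the barrier is no larger than at `p`.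
    (fun h => by rw [h] at hp2'; simp at hp2'; nlinarith) (hpos p hpb) hder (by
      filter_upwards [hlm, (show ContinuousAt (fun x => ‖x - y‖) p by fun_prop).eventually_lt_const
        hpltR] with x h1 h2 h3
      simp only [hφ, hw, h3] at h1
      have h4 : (R ^ 2 - ‖x - y‖ ^ 2) ^ 2 ≤ g ^ 2 := le_of_mul_le_mul_left (by linarith) hc
      have h5 := abs_le_of_sq_le_sq h4 hgpos.le
      linarith [le_abs_self (R ^ 2 - ‖x - y‖ ^ 2)])
  have h1 : w p < c * g ^ 2 := by simp only [hφ] at hφp; linarith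
  have h2 : 2 * c * g * ‖p - y‖ ^ 2 < c * g ^ 2 := lt_of_le_of_lt hle h1
  -- This reads 3|p - y|² < R², against R² ≤ 2|p - y|².
  have h3 : 2 * ‖p - y‖ ^ 2 < g := lt_of_mul_lt_mul_left (by linarith) (mul_pos hc hgpos).le
  rw [hg] at h3
  nlinarith [sq_nonneg ‖p - y‖]

/-! ### Zeros of Du -/

/-- At a zero of `Du` the second derivatives vanish as well. -/
theorem fderiv_eq_zero_of_eq_zero (hP : IsTangentialGradientSystem P Ω) (hΩ : IsOpen Ω)
    {x₀ : EuclideanSpace ℝ (Fin 2)} (hx₀ : x₀ ∈ Ω) (h0 : ∀ β, P β x₀ = 0) (α : ι) :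
    fderiv ℝ (P α) x₀ = 0 := by
  refine eq_zero_of_sum_inner_eq_zero (fun β => fderiv ℝ (P β) x₀)
    (fun β => hP.symm β x₀ hx₀) (fun α v => ?_) α
  -- Blow-up along x₀ + t v: dividing the system by t² and letting t → 0 leaves the same system for
  -- the linear maps DP_β(x₀).
  have hline : Tendsto (fun t : ℝ => x₀ + t • v) (𝓝[≠] 0) (𝓝 x₀) := by
    have : ContinuousAt (fun t : ℝ => x₀ + t • v) 0 := by fun_prop
    simpa [ContinuousAt] using this.mono_left nhdsWithin_le_nhds
  have hq : ∀ β, Tendsto (fun t : ℝ => t⁻¹ • P β (x₀ + t • v)) (𝓝[≠] 0)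
      (𝓝 (fderiv ℝ (P β) x₀ v)) := fun β => by
    simpa [h0] using ((hP.hasFDerivAt β hx₀).hasLineDerivAt v).tendsto_slope_zero
  have hA : ∀ β, Tendsto (fun t : ℝ => fderiv ℝ (P β) (x₀ + t • v)) (𝓝[≠] 0)
      (𝓝 (fderiv ℝ (P β) x₀)) := fun β => (hP.continuousAt_fderiv β hx₀).tendsto.comp hline
  have hAq : ∀ β, Tendsto (fun t : ℝ => fderiv ℝ (P β) (x₀ + t • v) (t⁻¹ • P α (x₀ + t • v)))
      (𝓝[≠] 0) (𝓝 (fderiv ℝ (P β) x₀ (fderiv ℝ (P α) x₀ v))) := fun β =>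
    (isBoundedBilinearMap_apply.continuous.tendsto (fderiv ℝ (P β) x₀, fderiv ℝ (P α) x₀ v)).comp
      ((hA β).prodMk_nhds (hq α))
  have hlim := tendsto_finsetSum Finset.univ fun β _ => (hAq β).inner (hq β) (𝕜 := ℝ)
  refine tendsto_nhds_unique hlim ((tendsto_const_nhds (x := (0 : ℝ))).congr' ?_)
  filter_upwards [hline.eventually (hΩ.mem_nhds hx₀)] with t ht
  have := hP.sum_inner_eq_zero α _ ht
  simp only [map_smul, inner_smul_left, inner_smul_right, ← Finset.mul_sum, this]
  simp

/-- A disc inside which `Du ≠ 0` has no zeros of `Du` on its boundary. -/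
theorem exists_ne_zero_of_mem_sphere (hP : IsTangentialGradientSystem P Ω) (hΩ : IsOpen Ω)
    {x₀ y : EuclideanSpace ℝ (Fin 2)} {R : ℝ} (hR : 0 < R) (hB : Metric.closedBall y R ⊆ Ω)
    (hpos : ∀ x ∈ Metric.ball y R, ∃ β, P β x ≠ 0) (hx₀ : x₀ ∈ Metric.sphere y R) :
    ∃ β, P β x₀ ≠ 0 := by
  by_contra! h0
  have hxΩ : x₀ ∈ Ω := hB (Metric.sphere_subset_closedBall hx₀)
  obtain ⟨c, hc, hcB⟩ := hP.exists_mul_sq_le_sum_norm_sq hΩ hR hB fun x hx => by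
    obtain ⟨β, hβ⟩ := hpos x hx
    exact Finset.sum_pos' (fun _ _ => by positivity) ⟨β, Finset.mem_univ β, by positivity⟩
  have hn : ‖x₀ - y‖ = R := by simpa [dist_eq_norm] using hx₀
  have hline : Tendsto (fun t : ℝ => ∑ β, ‖t⁻¹ • P β (x₀ + t • (y - x₀))‖ ^ 2) (𝓝[>] 0) (𝓝 0) := by
    have : ∀ β, Tendsto (fun t : ℝ => ‖t⁻¹ • P β (x₀ + t • (y - x₀))‖ ^ 2) (𝓝[>] 0) (𝓝 0) :=
      fun β => by
        have h1 := ((hP.hasFDerivAt β hxΩ).hasLineDerivAt (y - x₀)).tendsto_slope_zero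
        simp only [h0, sub_zero, hP.fderiv_eq_zero_of_eq_zero hΩ hxΩ h0 β] at h1
        simpa using ((h1.mono_left (nhdsGT_le_nhdsNE 0)).norm.pow 2)
    simpa using tendsto_finsetSum Finset.univ fun β _ => this β
  have hge : ∀ᶠ t in 𝓝[>] (0 : ℝ),
      c * R ^ 4 ≤ ∑ β, ‖t⁻¹ • P β (x₀ + t • (y - x₀))‖ ^ 2 := by
    -- For t < 1/4 one has 2(1 - t)² ≥ 1, so the point lies in the outer annulus where the Hopf
    -- bound holds; there R² - |x - y|² = R² t (2 - t) ≥ R² t.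
    filter_upwards [Ioo_mem_nhdsGT (show (0 : ℝ) < 1 / 4 by norm_num)] with t ht
    have h1 : ‖x₀ + t • (y - x₀) - y‖ = (1 - t) * R := by
      have : x₀ + t • (y - x₀) - y = (1 - t) • (x₀ - y) := by module
      rw [this, norm_smul, hn, Real.norm_of_nonneg (by linarith [ht.2])]
    have h2 := hcB (x₀ + t • (y - x₀))
      (by rw [Metric.mem_closedBall, dist_eq_norm, h1]; nlinarith [ht.1])
      (by
        have : 1 ≤ 2 * (1 - t) ^ 2 := by nlinarith [ht.1, ht.2]
        rw [h1, mul_pow]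
        nlinarith [pow_pos hR 2])
    rw [h1] at h2
    simp only [norm_smul, mul_pow, ← Finset.mul_sum]
    have h3 : 0 < t ^ 2 := pow_pos ht.1 2
    rw [norm_inv, inv_pow, Real.norm_eq_abs, sq_abs, inv_mul_eq_div, le_div_iff₀ h3]
    refine le_trans ?_ h2
    have h4 : R ^ 2 - ((1 - t) * R) ^ 2 = R ^ 2 * t * (2 - t) := by ring
    have h5 : 1 ≤ (2 - t) ^ 2 := by nlinarith [ht.2]
    have h6 : 0 ≤ c * R ^ 4 * t ^ 2 := by positivity
    rw [h4]
    nlinarith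
  have := ge_of_tendsto hline hge
  have h7 : 0 < c * R ^ 4 := by positivity
  linarith

/-- On a connected open set `Du` vanishes nowhere or everywhere. -/
theorem forall_exists_ne_zero_or_forall_eq_zero (hP : IsTangentialGradientSystem P Ω)
    (hΩ : IsOpen Ω) (hΩc : IsPreconnected Ω) :
    (∀ x ∈ Ω, ∃ β, P β x ≠ 0) ∨ ∀ x ∈ Ω, ∀ β, P β x = 0 := by
  by_contra! hcon
  obtain ⟨⟨z₁, hz₁, hz₁0⟩, ⟨z₂, hz₂, hz₂0⟩⟩ := hcon
  have hcont : ∀ β, ContinuousOn (P β) Ω := fun β x hx =>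
    (hP.contDiffAt β x hx).continuousAt.continuousWithinAt
  set U : Set (EuclideanSpace ℝ (Fin 2)) := {x | x ∈ Ω ∧ ∃ β, P β x ≠ 0} with hU
  have hUo : IsOpen U := by
    have : U = ⋃ β, Ω ∩ P β ⁻¹' {0}ᶜ := by
      ext x; simp [hU]
    rw [this]
    exact isOpen_iUnion fun β => (hcont β).isOpen_inter_preimage hΩ isOpen_compl_singleton
  obtain ⟨z, hzU, hzΩ, hz⟩ : ∃ z ∈ closure U, z ∈ Ω ∧ ∀ β, P β z = 0 := by
    by_contra! h
    have hsub := hΩc.subset_of_closure_inter_subset hUo ⟨z₂, hz₂, hz₂, hz₂0⟩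
      fun x hx => ⟨hx.2, h x hx.1 hx.2⟩
    obtain ⟨-, β, hβ⟩ := hsub hz₁
    exact hβ (hz₁0 β)
  obtain ⟨ε, hε, hball⟩ := Metric.nhds_basis_closedBall.mem_iff.1 (hΩ.mem_nhds hzΩ)
  -- The margin ε/2 keeps the disc about `y` reaching its nearest zero inside the ball of radius ε
  -- about `z`, so minimality within `Z` excludes every zero from its interior.
  obtain ⟨y, ⟨hyΩ, β₀, hyβ⟩, hyz⟩ := Metric.mem_closure_iff.1 hzU (ε / 2) (half_pos hε)
  set Z : Set (EuclideanSpace ℝ (Fin 2)) := Metric.closedBall z ε ∩ {x | ∀ β, P β x = 0} with hZ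
  have hZc : IsCompact Z := by
    have : Z = Metric.closedBall z ε ∩ ⋂ β, (Metric.closedBall z ε ∩ P β ⁻¹' {0}) := by
      ext x
      simp only [hZ, Set.mem_inter_iff, Set.mem_ofPred_eq, Set.mem_iInter, Set.mem_preimage,
        Set.mem_singleton_iff]
      grind
    rw [this]
    exact (isCompact_closedBall z ε).inter_right (isClosed_iInter fun β =>
      ((hcont β).mono hball).preimage_isClosed_of_isClosed Metric.isClosed_closedBall
        isClosed_singleton)
  have hzZ : z ∈ Z := ⟨Metric.mem_closedBall_self hε.le, hz⟩
  obtain ⟨x₀, hx₀, hmin⟩ := hZc.exists_isMinOn ⟨z, hzZ⟩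
    (f := fun x => dist x y) (by fun_prop)
  have hRz : dist x₀ y < ε / 2 := (hmin hzZ).trans_lt hyz
  have hR : 0 < dist x₀ y := dist_pos.2 fun h => hyβ (h ▸ hx₀.2 β₀)
  have hsub : Metric.closedBall y (dist x₀ y) ⊆ Metric.closedBall z ε :=
    Metric.closedBall_subset_closedBall' (by rw [dist_comm y z]; linarith)
  obtain ⟨β, hβ⟩ := hP.exists_ne_zero_of_mem_sphere hΩ hR (hsub.trans hball) (fun x hx => by
    by_contra! h
    have := hmin (a := x) ⟨hsub (Metric.ball_subset_closedBall hx), h⟩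
    exact absurd (Metric.mem_ball.1 hx) (not_lt.2 this)) (x₀ := x₀) rfl
  exact hβ (hx₀.2 β)

end IsTangentialGradientSystem

/-! ### From ∞-harmonic maps to tangential systems -/

section

variable {n N : ℕ}

theorem normalProj_mulVec (M : Matrix (Fin N) (Fin n) ℝ) (d : EuclideanSpace ℝ (Fin N))
    (α : Fin N) :
    ∑ β, normalProj M α β * d β = (transposeKer M).starProjection d α := by
  conv_rhs => rw [← (EuclideanSpace.basisFun (Fin N) ℝ).sum_repr d]
  simp [normalProj, mul_comm]

/-- Since `[M]^⊥` projects onto the orthogonal complement of the range of `M`, the tangential part of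
the system vanishes on its own. -/
theorem mulVec_eq_zero_of_add_normalProj_eq_zero (M : Matrix (Fin N) (Fin n) ℝ) (b : Fin n → ℝ)
    (d : EuclideanSpace ℝ (Fin N)) (k : ℝ)
    (h : ∀ α, ∑ i, M α i * b i + k * ∑ β, normalProj M α β * d β = 0) (α : Fin N) :
    ∑ i, M α i * b i = 0 := by
  set e := (transposeKer M).starProjection d with he
  have hker : ∀ i, ∑ α, M α i * e α = 0 := fun i => by
    have : e ∈ transposeKer M := (transposeKer M).starProjection_apply_mem d
    have h1 := congrArg (fun v => v i) (LinearMap.mem_ker.1 this)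
    simpa [Matrix.toLpLin_apply, Matrix.mulVec, dotProduct] using h1
  have horth : ∑ α, (∑ i, M α i * b i) * e α = 0 := by
    simp_rw [Finset.sum_mul]
    rw [Finset.sum_comm]
    refine Finset.sum_eq_zero fun i _ => ?_
    have := congrArg (fun s => b i * s) (hker i)
    simp only [Finset.mul_sum, mul_zero] at this
    rw [← this]
    exact Finset.sum_congr rfl fun α _ => by ring
  -- Pairing the system with M b leaves |M b|² = -k ⟪M b, e⟫, which is zero because `e` is
  -- orthogonal to the range of M.
  have hsq : ∑ α, (∑ i, M α i * b i) ^ 2 = 0 := by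
    have : ∀ α, (∑ i, M α i * b i) ^ 2 = -k * ((∑ i, M α i * b i) * e α) := fun α => by
      have := h α
      rw [normalProj_mulVec, ← he] at this
      linear_combination (∑ i, M α i * b i) * this
    rw [Finset.sum_congr rfl fun α _ => this α, ← Finset.mul_sum, horth, mul_zero]
  have := (Finset.sum_eq_zero_iff_of_nonneg fun α _ => sq_nonneg _).1 hsq α (Finset.mem_univ α)
  exact pow_eq_zero_iff two_ne_zero |>.1 this

theorem matrixNorm_eq_zero_iff (M : Matrix (Fin N) (Fin n) ℝ) :
    matrixNorm M = 0 ↔ ∀ α i, M α i = 0 := by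
  rw [matrixNorm, Real.sqrt_eq_zero (by positivity),
    Finset.sum_eq_zero_iff_of_nonneg fun _ _ => by positivity]
  simp only [Finset.mem_univ, true_imp_iff]
  refine forall_congr' fun α => ?_
  rw [Finset.sum_eq_zero_iff_of_nonneg fun _ _ => by positivity]
  simp

theorem matrixNorm_pos_iff (M : Matrix (Fin N) (Fin n) ℝ) :
    0 < matrixNorm M ↔ ∃ α i, M α i ≠ 0 := by
  rw [LE.le.lt_iff_ne (show 0 ≤ matrixNorm M from Real.sqrt_nonneg _), ne_comm, Ne, matrixNorm_eq_zero_iff]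
  push Not
  rfl

/-- The gradient vector `Du_α`. -/
noncomputable def gradRow (u : EuclideanSpace ℝ (Fin n) → EuclideanSpace ℝ (Fin N)) (α : Fin N)
    (x : EuclideanSpace ℝ (Fin n)) : EuclideanSpace ℝ (Fin n) :=
  WithLp.toLp 2 (gradMatrix u x α)

section

variable {u : EuclideanSpace ℝ (Fin n) → EuclideanSpace ℝ (Fin N)} {x : EuclideanSpace ℝ (Fin n)}

theorem contDiffAt_gradMatrix (hu : ContDiffAt ℝ 2 u x) (α : Fin N) (i : Fin n) :
    ContDiffAt ℝ 1 (fun y => gradMatrix u y α i) x := by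
  have h1 : ContDiffAt ℝ 2 (fun y => u y α) x := by fun_prop
  exact (h1.fderiv_right (m := 1) (by norm_num)).clm_apply contDiffAt_const

theorem contDiffAt_gradRow (hu : ContDiffAt ℝ 2 u x) (α : Fin N) :
    ContDiffAt ℝ 1 (gradRow u α) x :=
  contDiffAt_euclidean.2 fun i => contDiffAt_gradMatrix hu α i

theorem secondPartial_comm (hu : ContDiffAt ℝ 2 u x) (α : Fin N) (i j : Fin n) :
    secondPartial u x α i j = secondPartial u x α j i := by
  have h1 : ContDiffAt ℝ 2 (fun y => u y α) x := by fun_prop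
  have h2 : DifferentiableAt ℝ (fderiv ℝ fun y => u y α) x :=
    (h1.fderiv_right (m := 1) (by norm_num)).differentiableAt one_ne_zero
  have h3 : ∀ i j, secondPartial u x α i j = fderiv ℝ (fderiv ℝ fun y => u y α) x
      (EuclideanSpace.single j 1) (EuclideanSpace.single i 1) := fun i j => by
    simp only [secondPartial, gradMatrix, Matrix.of_apply]
    rw [fderiv_clm_apply h2 (differentiableAt_const _)]
    simp
  rw [h3, h3]
  exact (h1.isSymmSndFDerivAt (by simp)).eq _ _

theorem fderiv_gradRow_apply (hu : ContDiffAt ℝ 2 u x) (α : Fin N) (v : EuclideanSpace ℝ (Fin n))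
    (i : Fin n) : fderiv ℝ (gradRow u α) x v i = ∑ j, secondPartial u x α i j * v j := by
  have h1 := (EuclideanSpace.proj i : EuclideanSpace ℝ (Fin n) →L[ℝ] ℝ).hasFDerivAt.comp x
    ((contDiffAt_gradRow hu α).differentiableAt one_ne_zero).hasFDerivAt
  have h2 : fderiv ℝ (fun y => gradMatrix u y α i) x v = fderiv ℝ (gradRow u α) x v i := by
    have : (fun y => gradMatrix u y α i) =
      (EuclideanSpace.proj i : EuclideanSpace ℝ (Fin n) →L[ℝ] ℝ) ∘ gradRow u α := rfl
    rw [this, h1.fderiv]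
    rfl
  rw [← h2]
  conv_lhs => rw [← (EuclideanSpace.basisFun (Fin n) ℝ).sum_repr v]
  simp [secondPartial, mul_comm]

end

/-- The two terms of the ∞-Laplacian are mutually orthogonal, so the tangential one vanishes alone;
symmetry of the derivatives is that of the Hessians of the u_α. -/
theorem IsInftyHarmonicOn.isTangentialGradientSystem {Ω : Set (EuclideanSpace ℝ (Fin 2))}
    (hΩ : IsOpen Ω) {u : EuclideanSpace ℝ (Fin 2) → EuclideanSpace ℝ (Fin N)}
    (hu : IsInftyHarmonicOn u Ω) : IsTangentialGradientSystem (gradRow u) Ω := by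
  have hC : ∀ x ∈ Ω, ContDiffAt ℝ 2 u x := fun x hx => hu.1.contDiffAt (hΩ.mem_nhds hx)
  refine ⟨fun α x hx => contDiffAt_gradRow (hC x hx) α, fun α x hx v w => ?_, fun α x hx => ?_⟩
  · simp only [PiLp.inner_apply, Fin.sum_univ_two, RCLike.inner_apply, conj_trivial,
      fderiv_gradRow_apply (hC x hx), secondPartial_comm (hC x hx) α 1 0]
    ring
  · have h := mulVec_eq_zero_of_add_normalProj_eq_zero (gradMatrix u x)
      (fun i => ∑ j, ∑ β, gradMatrix u x β j * secondPartial u x β i j)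
      (WithLp.toLp 2 fun β => ∑ i, secondPartial u x β i i) (matrixNorm (gradMatrix u x) ^ 2)
      (fun α => by
        have := hu.2 x hx α
        simpa only [inftyLaplacian, Finset.mul_sum, mul_assoc] using this) α
    rw [← h]
    simp only [PiLp.inner_apply, Fin.sum_univ_two, RCLike.inner_apply, conj_trivial,
      fderiv_gradRow_apply (hC x hx), gradRow, Finset.mul_sum, ← Finset.sum_add_distrib,
      secondPartial_comm (hC x hx) _ 1 0]
    exact Finset.sum_congr rfl fun β _ => by ring

end

theorem corollary1p2 {N : ℕ} (Ω : Set (EuclideanSpace ℝ (Fin 2))) (hΩ : IsOpen Ω)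
    (hΩc : IsPreconnected Ω)
    (u : EuclideanSpace ℝ (Fin 2) → EuclideanSpace ℝ (Fin N))
    (hu : IsInftyHarmonicOn u Ω) :
    ((∀ x ∈ Ω, 0 < matrixNorm (gradMatrix u x)) ∨
      (∀ x ∈ Ω, matrixNorm (gradMatrix u x) = 0)) ∧
    ((¬ ∃ c, ∀ x ∈ Ω, u x = c) → ∀ x ∈ Ω, 0 < (gradMatrix u x).rank) := by
  have hrow : ∀ x β, gradRow u β x = 0 ↔ ∀ i, gradMatrix u x β i = 0 := fun x β => by
    constructor
    · intro h i
      exact congrArg (fun v => v i) h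
    · intro h
      ext i
      exact h i
  have hmain : (∀ x ∈ Ω, 0 < matrixNorm (gradMatrix u x)) ∨
      (∀ x ∈ Ω, matrixNorm (gradMatrix u x) = 0) := by
    have := (hu.isTangentialGradientSystem hΩ).forall_exists_ne_zero_or_forall_eq_zero hΩ hΩc
    simpa only [matrixNorm_pos_iff, matrixNorm_eq_zero_iff, Ne, hrow, not_forall] using this
  refine ⟨hmain, fun hnc x hx => ?_⟩
  rcases hmain with h | h
  · obtain ⟨α, i, hαi⟩ := (matrixNorm_pos_iff _).1 (h x hx)
    refine Nat.pos_of_ne_zero fun h0 => hαi ?_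
    rw [Matrix.rank, Submodule.finrank_eq_zero, LinearMap.range_eq_bot] at h0
    have := congrArg (fun L => L (Pi.single i 1) α) h0
    simpa using this
  · refine absurd ?_ hnc
    have hdiff : DifferentiableOn ℝ u Ω := hu.1.differentiableOn two_ne_zero
    refine hΩ.exists_is_const_of_fderiv_eq_zero (𝕜 := ℝ) hΩc hdiff fun y hy => ?_
    have hy' := (hdiff y hy).differentiableAt (hΩ.mem_nhds hy)
    refine ContinuousLinearMap.coe_injective
      ((EuclideanSpace.basisFun (Fin 2) ℝ).toBasis.ext fun i => ?_)
    ext α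
    have h1 := (matrixNorm_eq_zero_iff _).1 (h y hy) α i
    have h2 := (EuclideanSpace.proj α : EuclideanSpace ℝ (Fin N) →L[ℝ] ℝ).hasFDerivAt.comp y
      hy'.hasFDerivAt
    have h3 : fderiv ℝ (fun z => u z α) y = _ := h2.fderiv
    simp only [gradMatrix, Matrix.of_apply, h3] at h1
    simpa using h1
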